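/- Let $K$ be a field and let $\Lambda$ and $\Gamma$ be finite-dimensional associative unital (not necessarily commutative) $K$-algebras. For a ring $A$, let $\operatorname{mod} A$ be the category of finitely generated left $A$-modules. For $A$ a finite-dimensional $K$-algebra and a positive integer $j$, a maximal $j$-orthogonal subcategory of $\operatorname{mod} A$ is a full subcategory $\mathscr{C}\subseteq\operatorname{mod} A$ such that: (a) $\mathscr{C}$ is functorially finite in $\operatorname{mod} A$: for every $D\in\operatorname{mod} A$ there are a morphism $D\to C$ with $C\in\mathscr{C}$ through which every morphism from $D$ to an object of $\mathscr{C}$ factors, and a morphism $C'\to D$ with $C'\in\mathscr{C}$ through which every morphism from an object of $\mathscr{C}$ to $D$ factors; (b) $\mathscr{C}=\{X\in\operatorname{mod} A \mid \operatorname{Ext}_A^i(X,C)=0 \text{ for all } C\in\mathscr{C},\ 1\le i\le j\}=\{X\in\operatorname{mod} A \mid \operatorname{Ext}_A^i(C,X)=0 \text{ for all } C\in\mathscr{C},\ 1\le i\le j\}$. Write $\mathbb{D}\Gamma^{op}=\operatorname{Hom}_K(\Gamma,K)$ for the $K$-dual of the right regular module $\Gamma_\Gamma$, a left $\Gamma$-module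 through $(\gamma f)(x)=f(x\gamma)$. **Proposition 5.1.** Suppose that the injective dimension $\operatorname{id}_\Lambda\Lambda$ of the left regular module is equal to an integer $n\ge 1$, and that $\operatorname{mod}(\Lambda\otimes_K\Gamma)$ has a maximal $j$-orthogonal subcategory for some $j\ge n$. Then $\operatorname{Hom}_\Gamma(\mathbb{D}\Gamma^{op},\Gamma)=0$. -/

import Mathlib

open CategoryTheory
open scoped TensorProduct

universe u

section RegularDual

variable (K : Type u) (Γ : Type u) [Field K] [Ring Γ] [Algebra K Γ]

/-- The underlying `K`-vector space `Hom_K(Γ, K)` of the `K`-dual of the right regular module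
`Γ_Γ`. It is a type synonym, so that its left `Γ`-module structure below cannot clash with the
structures that linear maps carry already. -/
def RegularDual : Type u := Γ →ₗ[K] K

noncomputable instance : AddCommGroup (RegularDual K Γ) :=
  inferInstanceAs (AddCommGroup (Γ →ₗ[K] K))

noncomputable instance : Module K (RegularDual K Γ) :=
  inferInstanceAs (Module K (Γ →ₗ[K] K))

/-- The left `Γ`-module structure on the dual of the right regular module:
`(γ • f) x = f (x * γ)`. -/
noncomputable instance : Module Γ (RegularDual K Γ) where
  smul γ f := LinearMap.comp (show Γ →ₗ[K] K from f) (LinearMap.mulRight K γ)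
  one_smul f := by
    refine LinearMap.ext fun x => ?_
    change (show Γ →ₗ[K] K from f) (x * 1) = (show Γ →ₗ[K] K from f) x
    rw [mul_one]
  mul_smul a b f := by
    refine LinearMap.ext fun x => ?_
    change (show Γ →ₗ[K] K from f) (x * (a * b)) = (show Γ →ₗ[K] K from f) (x * a * b)
    rw [mul_assoc]
  smul_zero a := rfl
  smul_add a f g := rfl
  add_smul a b f := by
    refine LinearMap.ext fun x => ?_
    change (show Γ →ₗ[K] K from f) (x * (a + b)) =
      (show Γ →ₗ[K] K from f) (x * a) + (show Γ →ₗ[K] K from f) (x * b)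
    rw [mul_add, map_add]
  zero_smul f := by
    refine LinearMap.ext fun x => ?_
    change (show Γ →ₗ[K] K from f) (x * 0) = 0
    rw [mul_zero, map_zero]

end RegularDual

section Orthogonal

variable {A : Type u} [Ring A]

/-- `f : D ⟶ C` is a left `𝒞`-approximation of `D`: `C` is in `𝒞`, and every morphism from `D`
to an object of `𝒞` factors through `f`. -/
def IsLeftApproximation (𝒞 : ObjectProperty (ModuleCat.{u} A)) {D C : ModuleCat.{u} A}
    (f : D ⟶ C) : Prop :=
  𝒞 C ∧ ∀ ⦃C' : ModuleCat.{u} A⦄, 𝒞 C' → ∀ g : D ⟶ C', ∃ h : C ⟶ C', f ≫ h = g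

/-- `f : C ⟶ D` is a right `𝒞`-approximation of `D`: `C` is in `𝒞`, and every morphism from an
object of `𝒞` to `D` factors through `f`. -/
def IsRightApproximation (𝒞 : ObjectProperty (ModuleCat.{u} A)) {C D : ModuleCat.{u} A}
    (f : C ⟶ D) : Prop :=
  𝒞 C ∧ ∀ ⦃C' : ModuleCat.{u} A⦄, 𝒞 C' → ∀ g : C' ⟶ D, ∃ h : C' ⟶ C, h ≫ f = g

/-- Every object of `𝒟` has a left `𝒞`-approximation. -/
def IsCovariantlyFinite (𝒞 𝒟 : ObjectProperty (ModuleCat.{u} A)) : Prop :=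
  ∀ ⦃D : ModuleCat.{u} A⦄, 𝒟 D → ∃ (C : ModuleCat.{u} A) (f : D ⟶ C), IsLeftApproximation 𝒞 f

/-- Every object of `𝒟` has a right `𝒞`-approximation. -/
def IsContravariantlyFinite (𝒞 𝒟 : ObjectProperty (ModuleCat.{u} A)) : Prop :=
  ∀ ⦃D : ModuleCat.{u} A⦄, 𝒟 D → ∃ (C : ModuleCat.{u} A) (f : C ⟶ D), IsRightApproximation 𝒞 f

/-- `𝒞` is functorially finite in `𝒟`. -/
def IsFunctoriallyFinite (𝒞 𝒟 : ObjectProperty (ModuleCat.{u} A)) : Prop :=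
  IsCovariantlyFinite 𝒞 𝒟 ∧ IsContravariantlyFinite 𝒞 𝒟

/-- The finitely generated modules `X` with `Ext^i(X, C) = 0` for all `C` in `𝒞` and
`1 ≤ i ≤ n`. -/
def leftOrthogonal (n : ℕ) (𝒞 : ObjectProperty (ModuleCat.{u} A)) :
    ObjectProperty (ModuleCat.{u} A) :=
  fun X => ModuleCat.isFG A X ∧ ∀ ⦃C : ModuleCat.{u} A⦄, 𝒞 C →
    ∀ i : ℕ, 1 ≤ i → i ≤ n → Subsingleton (Abelian.Ext.{u} X C i)

/-- The finitely generated modules `X` with `Ext^i(C, X) = 0` for all `C` in `𝒞` and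
`1 ≤ i ≤ n`. -/
def rightOrthogonal (n : ℕ) (𝒞 : ObjectProperty (ModuleCat.{u} A)) :
    ObjectProperty (ModuleCat.{u} A) :=
  fun X => ModuleCat.isFG A X ∧ ∀ ⦃C : ModuleCat.{u} A⦄, 𝒞 C →
    ∀ i : ℕ, 1 ≤ i → i ≤ n → Subsingleton (Abelian.Ext.{u} C X i)

/-- `𝒞` is a maximal `n`-orthogonal subcategory of `𝒟`, for full subcategories `𝒞 ⊆ 𝒟` of the
category of finitely generated left `A`-modules. -/
structure IsMaximalOrthogonal (n : ℕ) (𝒞 𝒟 : ObjectProperty (ModuleCat.{u} A)) : Prop where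
  le : 𝒞 ≤ 𝒟
  le_isFG : 𝒟 ≤ ModuleCat.isFG A
  functoriallyFinite : IsFunctoriallyFinite 𝒞 𝒟
  eq_left : 𝒞 = leftOrthogonal n 𝒞 ⊓ 𝒟
  eq_right : 𝒞 = rightOrthogonal n 𝒞 ⊓ 𝒟

end Orthogonal

/-!
Let `A = Λ ⊗ Γ`. A maximal `j`-orthogonal subcategory of `mod A` contains the projective module `A`
and the injective module `DA`, so `Ext_A^n(DA, A) = 0`, where `DA ≅ Hom_Λ(A, DΛ)` is coextended from
`Λ`. Given `f : DΓ → Γ` and `x` with `f x ≠ 0`, choose a functional `φ` with `φ (f x) = 1`. The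
functional `x` embeds `Λ` in its coextension `Hom_Λ(A, Λ) ≃ Λ ⊗ DΓ` as `Λ ⊗ x`, the map `f` sends
this to `Λ ⊗ f x ⊆ A`, and slicing by `φ` returns to `Λ`. As the first map is natural, an element of
`Ext_Λ^n(DΛ, Λ)` is recovered from its image in `Ext_A^n(DA, A) = 0`, so it vanishes. Every cyclic
`Λ`-module embeds in a power of `DΛ`, and `Ext_Λ^n(-, Λ)` turns monomorphisms into epimorphisms
because `id Λ ≤ n`; hence `Ext_Λ^n(Λ/I, Λ) = 0` for every left ideal `I`, and Baer's criterion gives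
`id Λ < n`.
-/

namespace RegularDual

section

variable {K Γ : Type u} [Field K] [Ring Γ] [Algebra K Γ]

instance : IsScalarTower K Γ (RegularDual K Γ) where
  smul_assoc c γ f := LinearMap.ext fun x =>
    (congrArg f.toFun (mul_smul_comm c x γ)).trans (LinearMap.map_smul f c (x * γ))

instance [FiniteDimensional K Γ] : Module.Finite Γ (RegularDual K Γ) :=
  have : Module.Finite K (RegularDual K Γ) := inferInstanceAs (Module.Finite K (Γ →ₗ[K] K))
  Module.Finite.of_restrictScalars_finite K Γ _

/-- The linear functional underlying an element of `RegularDual K Γ`. -/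
noncomputable def toDual : RegularDual K Γ ≃ₗ[K] Module.Dual K Γ :=
  LinearEquiv.refl K (Γ →ₗ[K] K)

theorem toDual_smul (γ : Γ) (x : RegularDual K Γ) :
    toDual (γ • x) = toDual x ∘ₗ LinearMap.mulRight K γ :=
  rfl

/-- Evaluation at `1`, the universal functional on `RegularDual K Γ`: composing with it identifies
`Γ`-linear maps `M → RegularDual K Γ` with functionals on `M`, see `RegularDual.lift`. -/
noncomputable def evalOne : RegularDual K Γ →ₗ[K] K :=
  LinearMap.applyₗ 1 ∘ₗ toDual.toLinearMap

theorem evalOne_smul (γ : Γ) (x : RegularDual K Γ) : evalOne (γ • x) = toDual x γ :=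
  congrArg (toDual x) (one_mul γ)

theorem ext_evalOne {x y : RegularDual K Γ} (h : ∀ γ : Γ, evalOne (γ • x) = evalOne (γ • y)) :
    x = y :=
  toDual.injective (LinearMap.ext fun γ => by simpa only [evalOne_smul] using h γ)

variable {M : Type*} [AddCommGroup M] [Module K M] [Module Γ M] [IsScalarTower K Γ M]

/-- The `Γ`-linear map `m ↦ (γ ↦ φ (γ • m))` corresponding to a functional `φ` on a `Γ`-module. -/
def lift (φ : M →ₗ[K] K) : M →ₗ[Γ] RegularDual K Γ where
  toFun m := φ ∘ₗ (LinearMap.toSpanSingleton Γ M m).restrictScalars K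
  map_add' m m' := LinearMap.ext fun γ => (congrArg φ (smul_add γ m m')).trans (map_add φ _ _)
  map_smul' γ m := LinearMap.ext fun x => (congrArg φ (mul_smul x γ m)).symm

theorem evalOne_lift (φ : M →ₗ[K] K) (m : M) : evalOne (lift (Γ := Γ) φ m) = φ m :=
  congrArg φ (one_smul Γ m)

theorem exists_injective_pi [FiniteDimensional K M] :
    ∃ (d : ℕ) (g : M →ₗ[Γ] (Fin d → RegularDual K Γ)), Function.Injective g := by
  let b := Module.finBasis K M
  refine ⟨_, LinearMap.pi fun i => lift (b.coord i), ?_⟩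
  refine (injective_iff_map_eq_zero _).mpr fun m hm => b.forall_coord_eq_zero_iff.mp fun i => ?_
  rw [← evalOne_lift (Γ := Γ) (b.coord i) m, ← map_zero (evalOne (K := K) (Γ := Γ))]
  exact congrArg evalOne (congrFun hm i)

end

variable (K Γ : Type u) [Field K] [Ring Γ] [Algebra K Γ]

theorem injective : Module.Injective Γ (RegularDual K Γ) := by
  refine Module.Baer.injective fun I g => ?_
  obtain ⟨φ, hφ⟩ := LinearMap.exists_extend (p := I.restrictScalars K)
    (evalOne ∘ₗ g.restrictScalars K)
  refine ⟨lift φ, fun x hx => ext_evalOne fun γ => ?_⟩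
  calc evalOne (γ • lift φ x) = φ (γ * x) := by rw [← map_smul, evalOne_lift, smul_eq_mul]
    _ = evalOne (g (γ • ⟨x, hx⟩)) := LinearMap.congr_fun hφ ⟨γ * x, I.mul_mem_left γ hx⟩
    _ = evalOne (γ • g ⟨x, hx⟩) := by rw [map_smul]

instance : Injective (ModuleCat.of Γ (RegularDual K Γ)) :=
  (Module.injective_iff_injective_object _ _).mp (injective K Γ)

end RegularDual

section Ext

open Abelian Limits

universe w w' v v' u₁ u₂

variable {C : Type u₁} [Category.{v} C] [Abelian C] [HasExt.{w} C]

theorem subsingleton_ext_of_iso {X X' Y : C} {n : ℕ} (i : X ≅ X')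
    [Subsingleton (Ext.{w} X' Y n)] : Subsingleton (Ext.{w} X Y n) :=
  have : Subsingleton (((extFunctor.{w} n).obj (.op X')).obj Y) := ‹_›
  (((extFunctor.{w} n).mapIso i.op).app Y).symm.addCommGroupIsoToAddEquiv.subsingleton

theorem subsingleton_ext_of_mono {X M Y : C} {n : ℕ} (f : X ⟶ M) [Mono f]
    [HasInjectiveDimensionLT Y (n + 1)] [Subsingleton (Ext.{w} M Y n)] :
    Subsingleton (Ext.{w} X Y n) := by
  refine subsingleton_of_forall_eq 0 fun e => ?_
  have hS : (ShortComplex.mk _ _ (cokernel.condition f)).ShortExact :=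
    { exact := ShortComplex.exact_cokernel f }
  obtain ⟨e', rfl⟩ := Ext.contravariant_sequence_exact₁ hS Y e (add_comm 1 n)
    (Ext.eq_zero_of_hasInjectiveDimensionLT _ (n + 1) le_rfl)
  rw [Subsingleton.elim e' 0, Ext.comp_zero]

variable {D : Type u₂} [Category.{v'} D] [Abelian D] [HasExt.{w'} D]
variable (F : C ⥤ D) [F.Additive] [PreservesFiniteLimits F] [PreservesFiniteColimits F]
variable (G : D ⥤ C) [G.Additive] [PreservesFiniteLimits G] [PreservesFiniteColimits G]

theorem mk₀_comp_mapExactFunctor_mapExactFunctor [EnoughProjectives C]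
    (η : 𝟭 C ⟶ F ⋙ G) {X Y : C} {n : ℕ} (e : Ext.{w} X Y n) :
    (Ext.mk₀ (η.app X)).comp ((e.mapExactFunctor F).mapExactFunctor G) (zero_add n) =
      e.comp (Ext.mk₀ (η.app Y)) (add_zero n) := by
  induction n generalizing X with
  | zero =>
    obtain ⟨f, rfl⟩ := Ext.homEquiv₀.symm.surjective e
    have hf : η.app X ≫ G.map (F.map f) = f ≫ η.app Y := (η.naturality f).symm
    simp only [Functor.id_obj, Ext.homEquiv₀_symm_apply, Ext.mapExactFunctor_mk₀,
      Ext.mk₀_comp_mk₀, hf]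
  | succ n ih =>
    let P : ProjectivePresentation X := Classical.arbitrary _
    have : Projective P.p := P.projective
    let S := ShortComplex.mk _ _ (kernel.condition P.f)
    have hS : S.ShortExact := { exact := ShortComplex.exact_kernel P.f }
    obtain ⟨e, rfl⟩ := Ext.contravariant_sequence_exact₃ hS Y e (Ext.eq_zero_of_projective _)
      (add_comm 1 n)
    have hGF : (hS.extClass.mapExactFunctor F).mapExactFunctor G =
        ((hS.map_of_exact F).map_of_exact G).extClass :=
      (congrArg (Ext.mapExactFunctor G) (Ext.mapExactFunctor_extClass F hS)).trans
        (Ext.mapExactFunctor_extClass G (hS.map_of_exact F))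
    have hη : (Ext.mk₀ (η.app S.X₃)).comp ((hS.extClass.mapExactFunctor F).mapExactFunctor G)
        (zero_add 1) = hS.extClass.comp (Ext.mk₀ (η.app S.X₁)) (add_zero 1) := by
      rw [hGF]
      exact (hS.extClass_naturality ((hS.map_of_exact F).map_of_exact G) (S.mapNatTrans η)).symm
    rw [Ext.mapExactFunctor_comp, Ext.mapExactFunctor_comp,
      ← Ext.comp_assoc (Ext.mk₀ (η.app S.X₃)) _ _ (zero_add 1) (add_comm 1 n) (by lia), hη,
      Ext.comp_assoc hS.extClass (Ext.mk₀ (η.app S.X₁)) _ (add_zero 1) (zero_add n) (by lia), ih,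
      Ext.comp_assoc hS.extClass e _ (add_comm 1 n) (add_zero n) (by lia)]

variable {F G}

theorem subsingleton_ext_of_retract_map [EnoughProjectives C]
    (η : 𝟭 C ⟶ F ⋙ G) {X Y : C} {Z : D} (ψ : F.obj Y ⟶ Z) (ρ : G.obj Z ⟶ Y)
    (hρ : η.app Y ≫ G.map ψ ≫ ρ = 𝟙 Y) {n : ℕ} [Subsingleton (Ext.{w'} (F.obj X) Z n)] :
    Subsingleton (Ext.{w} X Y n) := by
  refine subsingleton_of_forall_eq 0 fun e => ?_
  have hψ : ((e.mapExactFunctor F).mapExactFunctor G).comp (Ext.mk₀ (G.map ψ)) (add_zero n) =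
      0 := by
    rw [← Ext.mapExactFunctor_mk₀, ← Ext.mapExactFunctor_comp,
      Subsingleton.elim ((e.mapExactFunctor F).comp (Ext.mk₀ ψ) (add_zero n)) 0,
      Ext.mapExactFunctor_zero]
  -- By naturality, `e` is recovered from `F e` composed with `ψ`, an element of `Ext^n(F X, Z)`.
  calc e = (e.comp (Ext.mk₀ (η.app Y)) (add_zero n)).comp
        (Ext.mk₀ (G.map ψ ≫ ρ)) (add_zero n) := by
        rw [Ext.comp_assoc_of_third_deg_zero, Ext.mk₀_comp_mk₀, hρ]
        exact (Ext.comp_mk₀_id e).symm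
    _ = (Ext.mk₀ (η.app X)).comp ((((e.mapExactFunctor F).mapExactFunctor G).comp
        (Ext.mk₀ (G.map ψ)) (add_zero n)).comp (Ext.mk₀ ρ) (add_zero n)) (zero_add n) := by
        rw [← mk₀_comp_mapExactFunctor_mapExactFunctor, Ext.comp_assoc_of_third_deg_zero,
          Ext.comp_assoc_of_third_deg_zero, Ext.mk₀_comp_mk₀]
    _ = 0 := by rw [hψ, Ext.zero_comp, Ext.comp_zero]

end Ext

section InjectiveDimension

open Abelian Limits

variable {R : Type u} [Ring R]

theorem isZero_of_subsingleton_ext_zero (N : ModuleCat.{u} R)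
    (h : ∀ I : Ideal R, Subsingleton (Ext.{u} (ModuleCat.of R (R ⧸ I)) N 0)) : IsZero N := by
  rw [ModuleCat.isZero_iff_subsingleton]
  refine subsingleton_of_forall_eq 0 fun x => ?_
  let g : ModuleCat.of R (R ⧸ (⊥ : Ideal R)) ⟶ N :=
    ModuleCat.ofHom (Submodule.liftQ ⊥ (LinearMap.toSpanSingleton R N x) bot_le)
  have hg : g = 0 := Ext.homEquiv₀.symm.injective ((h ⊥).elim _ _)
  calc x = g (Submodule.Quotient.mk 1) := (one_smul R x).symm
    _ = 0 := by rw [hg]; rfl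

theorem baer_of_subsingleton_ext_one (N : ModuleCat.{u} R)
    (h : ∀ I : Ideal R, Subsingleton (Ext.{u} (ModuleCat.of R (R ⧸ I)) N 1)) :
    Module.Baer R N := by
  intro I g
  have hS : (ShortComplex.moduleCatMk I.subtype I.mkQ (by ext x; simp)).ShortExact :=
    ModuleCat.shortComplex_shortExact _ (LinearMap.exact_subtype_mkQ I)
      I.injective_subtype I.mkQ_surjective
  obtain ⟨e, he⟩ := Ext.contravariant_sequence_exact₁ hS N (Ext.mk₀ (ModuleCat.ofHom g))
    (add_zero 1) ((h I).elim _ _)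
  obtain ⟨g', rfl⟩ := Ext.homEquiv₀.symm.surjective e
  rw [Ext.homEquiv₀_symm_apply, Ext.mk₀_comp_mk₀] at he
  have hg' := Ext.homEquiv₀.symm.injective he
  exact ⟨g'.hom, fun x hx => congrArg (fun k => k.hom ⟨x, hx⟩) hg'⟩

theorem hasInjectiveDimensionLT_of_subsingleton_ext_quotient (N : ModuleCat.{u} R) (n : ℕ)
    (h : ∀ I : Ideal R, Subsingleton (Ext.{u} (ModuleCat.of R (R ⧸ I)) N n)) :
    HasInjectiveDimensionLT N n := by
  induction n generalizing N with
  | zero =>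
    rw [hasInjectiveDimensionLT_zero_iff_isZero]
    exact isZero_of_subsingleton_ext_zero N h
  | succ n ih =>
    obtain rfl | n := n
    · rw [zero_add, ← injective_iff_hasInjectiveDimensionLT_one,
        ← Module.injective_iff_injective_object, ← Module.Baer.iff_injective]
      exact baer_of_subsingleton_ext_one N h
    · have hS : (ShortComplex.mk _ _ (cokernel.condition (Injective.ι N))).ShortExact :=
        { exact := ShortComplex.exact_cokernel (Injective.ι N) }
      refine (hS.hasInjectiveDimensionLT_X₃_iff n inferInstance).mp (ih _ fun I => ?_)
      refine subsingleton_of_forall_eq 0 fun e => ?_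
      obtain ⟨e', rfl⟩ := Ext.covariant_sequence_exact₃ _ hS e rfl ((h I).elim _ _)
      rw [Ext.eq_zero_of_injective e', Ext.zero_comp]

theorem hasInjectiveDimensionLT_of_subsingleton_ext_regularDual (K : Type u) {Λ : Type u} [Field K]
    [Ring Λ] [Algebra K Λ] [FiniteDimensional K Λ] (N : ModuleCat.{u} Λ) (n : ℕ)
    [HasInjectiveDimensionLT N (n + 1)]
    [Subsingleton (Ext.{u} (ModuleCat.of Λ (RegularDual K Λ)) N n)] :
    HasInjectiveDimensionLT N n := by
  refine hasInjectiveDimensionLT_of_subsingleton_ext_quotient N n fun I => ?_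
  obtain ⟨d, g, hg⟩ := RegularDual.exists_injective_pi (K := K) (Γ := Λ) (M := Λ ⧸ I)
  let X : Fin d → ModuleCat.{u} Λ := fun _ => ModuleCat.of Λ (RegularDual K Λ)
  have : Subsingleton (Ext.{u} (⨁ X) N n) :=
    (Ext.biproductAddEquiv (biproduct.isBilimit X) N n).subsingleton
  have : Mono (ModuleCat.ofHom g) := (ModuleCat.mono_iff_injective _).mpr hg
  exact subsingleton_ext_of_mono (ModuleCat.ofHom g ≫ (ModuleCat.biproductIsoPi X).inv)

end InjectiveDimension

section ChangeOfRings

open Limits ModuleCat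

variable {R S : Type u} [Ring R] [Ring S] (ι : R →+* S)

instance coextendScalars_additive : (coextendScalars.{u, u, u} ι).Additive :=
  (restrictCoextendScalarsAdj.{u} ι).right_adjoint_additive

instance coextendScalars_preservesFiniteLimits :
    PreservesFiniteLimits (coextendScalars.{u, u, u} ι) :=
  have := (restrictCoextendScalarsAdj.{u} ι).rightAdjoint_preservesLimits
  inferInstance

theorem epi_coextendScalars_map [Module.Projective R ((restrictScalars ι).obj (of S S))]
    {M N : ModuleCat.{u} R} (g : M ⟶ N) [Epi g] : Epi ((coextendScalars ι).map g) := by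
  rw [ModuleCat.epi_iff_surjective]
  intro h
  obtain ⟨h', hh'⟩ := Module.projective_lifting_property g.hom (CoextendScalars.equiv ι N h)
    ((ModuleCat.epi_iff_surjective g).mp inferInstance)
  exact ⟨(CoextendScalars.equiv ι M).symm h', CoextendScalars.ext hh'⟩

theorem coextendScalars_preservesFiniteColimits
    [Module.Projective R ((restrictScalars ι).obj (of S S))] :
    PreservesFiniteColimits (coextendScalars.{u, u, u} ι) := by
  have : (coextendScalars.{u, u, u} ι).PreservesEpimorphisms :=
    ⟨fun g _ => epi_coextendScalars_map ι g⟩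
  have := Functor.preservesHomology_of_preservesEpis_and_kernels (coextendScalars.{u, u, u} ι)
  exact Functor.preservesFiniteColimits_of_preservesHomology _

theorem restrictScalars_preservesFiniteLimits_and_colimits :
    PreservesFiniteLimits (restrictScalars.{u} ι) ∧
      PreservesFiniteColimits (restrictScalars.{u} ι) := by
  refine ((Functor.exact_tfae (restrictScalars.{u} ι)).out 1 3).mp fun T hT => ?_
  rw [ShortComplex.ShortExact.moduleCat_exact_iff_function_exact] at hT ⊢
  exact hT

end ChangeOfRings

section TensorProduct

open ModuleCat TensorProduct

section

variable (K Λ Γ : Type u) [CommRing K] [Ring Λ] [Algebra K Λ] [Ring Γ] [Algebra K Γ]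

/-- Coextension of scalars `Hom_Λ(Λ ⊗ Γ, -)` along `l ↦ l ⊗ 1`. -/
noncomputable abbrev coextendTensor : ModuleCat.{u} Λ ⥤ ModuleCat.{u} (Λ ⊗[K] Γ) :=
  coextendScalars.{u, u, u} Algebra.TensorProduct.includeLeftRingHom

/-- Restriction of scalars along `l ↦ l ⊗ 1`. -/
noncomputable abbrev restrictTensor : ModuleCat.{u} (Λ ⊗[K] Γ) ⥤ ModuleCat.{u} Λ :=
  restrictScalars.{u} Algebra.TensorProduct.includeLeftRingHom

/-- The action of `Λ` on `Λ ⊗ Γ` through the left factor agrees with restriction of scalars. -/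
noncomputable def restrictTensorEquiv :
    Λ ⊗[K] Γ ≃ₗ[Λ] (restrictTensor K Λ Γ).obj (of (Λ ⊗[K] Γ) (Λ ⊗[K] Γ)) where
  __ := AddEquiv.refl _
  map_smul' l a := by
    change l • a = l ⊗ₜ[K] (1 : Γ) * a
    calc l • a = (l • (1 : Λ ⊗[K] Γ)) * a := by rw [smul_mul_assoc, one_mul]
      _ = l ⊗ₜ[K] (1 : Γ) * a := by
        rw [Algebra.TensorProduct.one_def, smul_tmul', smul_eq_mul, mul_one]

instance [Module.Free K Γ] :
    Module.Free Λ ((restrictTensor K Λ Γ).obj (of (Λ ⊗[K] Γ) (Λ ⊗[K] Γ))) :=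
  Module.Free.of_equiv (restrictTensorEquiv K Λ Γ)

instance [Module.Free K Γ] : Limits.PreservesFiniteColimits (coextendTensor K Λ Γ) :=
  coextendScalars_preservesFiniteColimits _

instance : Limits.PreservesFiniteLimits (restrictTensor K Λ Γ) :=
  (restrictScalars_preservesFiniteLimits_and_colimits _).1

instance : Limits.PreservesFiniteColimits (restrictTensor K Λ Γ) :=
  (restrictScalars_preservesFiniteLimits_and_colimits _).2

variable {K Λ Γ}

/-- Elements of a coextended module are `Λ`-linear maps on `Λ ⊗ Γ`. -/
noncomputable def coextendTensorEquiv (M : ModuleCat.{u} Λ) :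
    (coextendTensor K Λ Γ).obj M ≃+ (Λ ⊗[K] Γ →ₗ[Λ] M) where
  toFun h := CoextendScalars.equiv _ M h ∘ₗ (restrictTensorEquiv K Λ Γ).toLinearMap
  invFun u := (CoextendScalars.equiv _ M).symm (u ∘ₗ (restrictTensorEquiv K Λ Γ).symm.toLinearMap)
  map_add' _ _ := rfl

/-- The slice map `id ⊗ φ : Λ ⊗ Γ → Λ` of a functional `φ` on `Γ`. -/
noncomputable def tensorSlice (φ : Module.Dual K Γ) : Λ ⊗[K] Γ →ₗ[Λ] Λ :=
  (AlgebraTensorModule.rid K Λ Λ).toLinearMap ∘ₗ AlgebraTensorModule.map LinearMap.id φ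

theorem tensorSlice_tmul (φ : Module.Dual K Γ) (l : Λ) (γ : Γ) :
    tensorSlice φ (l ⊗ₜ[K] γ) = φ γ • l := by
  simp only [tensorSlice, LinearMap.comp_apply, AlgebraTensorModule.map_tmul, LinearMap.id_apply,
    LinearEquiv.coe_coe, AlgebraTensorModule.rid_tmul]

theorem tensorSlice_mul_tmul_one (φ : Module.Dual K Γ) (a : Λ ⊗[K] Γ) (l : Λ) :
    tensorSlice φ (a * l ⊗ₜ[K] 1) = tensorSlice φ a * l := by
  induction a with
  | zero => simp only [zero_mul, map_zero]
  | add a b ha hb => simp only [add_mul, map_add, ha, hb]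
  | tmul l' γ =>
    rw [Algebra.TensorProduct.tmul_mul_tmul, mul_one, tensorSlice_tmul, tensorSlice_tmul,
      smul_mul_assoc]

/-- The natural map `M → Hom_Λ(Λ ⊗ Γ, M)`, `m ↦ (a ↦ tensorSlice φ a • m)`, of a functional `φ` on
`Γ`. -/
noncomputable def tensorSliceNatTrans (φ : Module.Dual K Γ) :
    𝟭 (ModuleCat.{u} Λ) ⟶ coextendTensor K Λ Γ ⋙ restrictTensor K Λ Γ where
  app M := ofHom (Y := (restrictTensor K Λ Γ).obj ((coextendTensor K Λ Γ).obj M))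
    { toFun m := (coextendTensorEquiv M).symm (LinearMap.toSpanSingleton Λ M m ∘ₗ tensorSlice φ)
      map_add' m m' := (coextendTensorEquiv M).injective <|
        LinearMap.ext fun a => smul_add (tensorSlice φ a) m m'
      map_smul' l m := (coextendTensorEquiv M).injective <| LinearMap.ext fun a =>
        (mul_smul (tensorSlice φ a) l m).symm.trans
          (congrArg (· • m) (tensorSlice_mul_tmul_one φ a l).symm) }
  naturality M N g := by
    ext m
    exact (coextendTensorEquiv N).injective <| LinearMap.ext fun a =>
      (map_smul g.hom (tensorSlice φ a) m).symm

end

variable {K Λ Γ : Type u} [Field K] [Ring Λ] [Algebra K Λ] [Ring Γ] [Algebra K Γ]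

/-- The adjunction isomorphism `Hom_K(Λ ⊗ Γ, K) ≃ Hom_Λ(Λ ⊗ Γ, Hom_K(Λ, K))`. -/
noncomputable def regularDualTensorEquiv :
    RegularDual K (Λ ⊗[K] Γ) ≃ₗ[Λ ⊗[K] Γ]
      (coextendTensor K Λ Γ).obj (of Λ (RegularDual K Λ)) where
  toFun x := (coextendTensorEquiv _).symm (RegularDual.lift (RegularDual.toDual x))
  invFun h := RegularDual.toDual.symm
    (RegularDual.evalOne ∘ₗ (coextendTensorEquiv _ h).restrictScalars K)
  map_add' _ _ := rfl
  map_smul' a x := (coextendTensorEquiv _).injective <| LinearMap.ext fun b =>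
    RegularDual.toDual.injective <| LinearMap.ext fun l =>
      congrArg (RegularDual.toDual x) (smul_mul_assoc l b a)
  left_inv x := LinearMap.ext fun a => RegularDual.evalOne_lift (RegularDual.toDual x) a
  right_inv h := (coextendTensorEquiv _).injective <| LinearMap.ext fun a =>
    RegularDual.ext_evalOne fun l =>
      calc RegularDual.evalOne (l • RegularDual.lift _ a)
          = RegularDual.evalOne (RegularDual.lift (M := Λ ⊗[K] Γ) _ (l • a)) :=
            congrArg _ (map_smul _ l a).symm
        _ = RegularDual.evalOne (coextendTensorEquiv _ h (l • a)) := RegularDual.evalOne_lift _ _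
        _ = RegularDual.evalOne (l • coextendTensorEquiv _ h a) := congrArg _ (map_smul _ l a)

/-- The `K`-linear map `γ ↦ h (1 ⊗ γ)`, which determines `h ∈ Hom_Λ(Λ ⊗ Γ, Λ)`. -/
noncomputable def evalOneTmul : (coextendTensor K Λ Γ).obj (of Λ Λ) →+ (Γ →ₗ[K] Λ) where
  toFun h := (coextendTensorEquiv _ h).restrictScalars K ∘ₗ TensorProduct.mk K Λ Γ 1
  map_zero' := rfl
  map_add' _ _ := rfl

theorem evalOneTmul_tmul_smul (l : Λ) (γ : Γ) (h : (coextendTensor K Λ Γ).obj (of Λ Λ)) :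
    evalOneTmul (l ⊗ₜ[K] γ • h) =
      LinearMap.mulLeft K l ∘ₗ evalOneTmul h ∘ₗ LinearMap.mulRight K γ := by
  refine LinearMap.ext fun y => ?_
  calc coextendTensorEquiv _ h (1 ⊗ₜ y * l ⊗ₜ γ)
      = coextendTensorEquiv _ h (l • (1 ⊗ₜ[K] (y * γ))) := by
        rw [Algebra.TensorProduct.tmul_mul_tmul, one_mul, smul_tmul', smul_eq_mul, mul_one]
    _ = l • coextendTensorEquiv _ h (1 ⊗ₜ[K] (y * γ)) := map_smul _ _ _

theorem evalOneTmul_tensorSliceNatTrans_app (x : RegularDual K Γ) (l : Λ) :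
    evalOneTmul ((tensorSliceNatTrans (RegularDual.toDual x)).app (of Λ Λ) l) =
      dualTensorHom K Γ Λ (RegularDual.toDual x ⊗ₜ l) := by
  refine LinearMap.ext fun y => ?_
  calc tensorSlice (RegularDual.toDual x) (1 ⊗ₜ y) * l = RegularDual.toDual x y • l := by
        rw [tensorSlice_tmul, smul_mul_assoc, one_mul]

variable [FiniteDimensional K Γ]

/-- The map `Hom_K(Γ, Λ) ≃ DΓ ⊗ Λ → Λ ⊗ Γ` induced by `f : DΓ → Γ`. -/
noncomputable def tensorContract (f : RegularDual K Γ →ₗ[Γ] Γ) : (Γ →ₗ[K] Λ) →ₗ[K] Λ ⊗[K] Γ :=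
  (TensorProduct.comm K Γ Λ).toLinearMap ∘ₗ
    (f.restrictScalars K ∘ₗ RegularDual.toDual.symm.toLinearMap).rTensor Λ ∘ₗ
      (dualTensorHomEquiv K Γ Λ).symm.toLinearMap

theorem tensorContract_dualTensorHom (f : RegularDual K Γ →ₗ[Γ] Γ) (x : RegularDual K Γ) (l : Λ) :
    tensorContract f (dualTensorHom K Γ Λ (RegularDual.toDual x ⊗ₜ l)) = l ⊗ₜ f x := by
  simp [tensorContract]

theorem tensorContract_mulLeft_comp_mulRight (f : RegularDual K Γ →ₗ[Γ] Γ) (l : Λ) (γ : Γ)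
    (u : Γ →ₗ[K] Λ) :
    tensorContract f (LinearMap.mulLeft K l ∘ₗ u ∘ₗ LinearMap.mulRight K γ) =
      l ⊗ₜ[K] γ * tensorContract f u := by
  obtain ⟨t, rfl⟩ := (dualTensorHomEquiv K Γ Λ).surjective u
  induction t with
  | zero => simp only [map_zero, LinearMap.zero_comp, LinearMap.comp_zero, mul_zero]
  | add t t' ht ht' => simp only [map_add, LinearMap.add_comp, LinearMap.comp_add, mul_add, ht, ht']
  | tmul φ l' =>
    obtain ⟨x, rfl⟩ := RegularDual.toDual.surjective φ
    have h : LinearMap.mulLeft K l ∘ₗ dualTensorHom K Γ Λ (RegularDual.toDual x ⊗ₜ l') ∘ₗ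
        LinearMap.mulRight K γ =
          dualTensorHom K Γ Λ (RegularDual.toDual (γ • x) ⊗ₜ (l * l')) := by
      ext y
      simp [RegularDual.toDual_smul]
    calc tensorContract f _
        = tensorContract f (dualTensorHom K Γ Λ (RegularDual.toDual (γ • x) ⊗ₜ (l * l'))) :=
          congrArg (tensorContract f) h
      _ = l ⊗ₜ γ * l' ⊗ₜ f x := by
          rw [tensorContract_dualTensorHom, map_smul, smul_eq_mul,
            Algebra.TensorProduct.tmul_mul_tmul]
      _ = l ⊗ₜ γ * tensorContract f (dualTensorHom K Γ Λ (RegularDual.toDual x ⊗ₜ l')) := by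
          rw [tensorContract_dualTensorHom]

/-- The `Λ ⊗ Γ`-linear map `Hom_Λ(Λ ⊗ Γ, Λ) → Λ ⊗ Γ` given by `tensorContract f`. -/
noncomputable def coextendTensorContract (f : RegularDual K Γ →ₗ[Γ] Γ) :
    (coextendTensor K Λ Γ).obj (of Λ Λ) →ₗ[Λ ⊗[K] Γ] Λ ⊗[K] Γ where
  toFun h := tensorContract f (evalOneTmul h)
  map_add' h h' := by rw [map_add, map_add]
  map_smul' a h := by
    rw [RingHom.id_apply]
    induction a with
    | zero => rw [zero_smul, zero_smul, map_zero, map_zero]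
    | add a a' ha ha' => rw [add_smul, add_smul, map_add, map_add, ha, ha']
    | tmul l γ => rw [evalOneTmul_tmul_smul, tensorContract_mulLeft_comp_mulRight, smul_eq_mul]

theorem coextendTensorContract_tensorSliceNatTrans_app (f : RegularDual K Γ →ₗ[Γ] Γ)
    (x : RegularDual K Γ) (l : Λ) :
    coextendTensorContract f ((tensorSliceNatTrans (RegularDual.toDual x)).app (of Λ Λ) l) =
      l ⊗ₜ f x :=
  (congrArg (tensorContract f) (evalOneTmul_tensorSliceNatTrans_app x l)).trans
    (tensorContract_dualTensorHom f x l)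

open Abelian in
theorem subsingleton_ext_of_coextendTensor {f : RegularDual K Γ →ₗ[Γ] Γ} (hf : f ≠ 0)
    (M : ModuleCat.{u} Λ) (n : ℕ)
    [Subsingleton (Ext.{u} ((coextendTensor K Λ Γ).obj M) (of (Λ ⊗[K] Γ) (Λ ⊗[K] Γ)) n)] :
    Subsingleton (Ext.{u} M (of Λ Λ) n) := by
  obtain ⟨x, hx⟩ : ∃ x, f x ≠ 0 := by
    by_contra! hx
    exact hf (LinearMap.ext hx)
  obtain ⟨φ, hφ⟩ := Module.Projective.exists_dual_eq_one K hx
  let η : 𝟭 _ ⟶ coextendTensor K Λ Γ ⋙ restrictTensor K Λ Γ :=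
    tensorSliceNatTrans (RegularDual.toDual x)
  let ψ : (coextendTensor K Λ Γ).obj (of Λ Λ) ⟶ of (Λ ⊗[K] Γ) (Λ ⊗[K] Γ) :=
    ofHom (coextendTensorContract f)
  let ρ : (restrictTensor K Λ Γ).obj (of (Λ ⊗[K] Γ) (Λ ⊗[K] Γ)) ⟶ of Λ Λ :=
    ofHom (X := (restrictTensor K Λ Γ).obj (of (Λ ⊗[K] Γ) (Λ ⊗[K] Γ)))
      (tensorSlice φ ∘ₗ (restrictTensorEquiv K Λ Γ).symm.toLinearMap)
  refine subsingleton_ext_of_retract_map η ψ ρ ?_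
  refine ModuleCat.hom_ext (LinearMap.ext fun (l : Λ) => ?_)
  calc tensorSlice φ (coextendTensorContract f (η.app (of Λ Λ) l))
      = tensorSlice φ (l ⊗ₜ f x) :=
        congrArg (tensorSlice φ) (coextendTensorContract_tensorSliceNatTrans_app f x l)
    _ = l := by rw [tensorSlice_tmul, hφ, one_smul]

end TensorProduct

section MaximalOrthogonal

open Abelian

namespace IsMaximalOrthogonal

variable {A : Type u} [Ring A] {j : ℕ} {𝒞 𝒟 : ObjectProperty (ModuleCat.{u} A)}

theorem mem_of_projective (h : IsMaximalOrthogonal j 𝒞 𝒟) {P : ModuleCat.{u} A} [Projective P]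
    (hP : 𝒟 P) : 𝒞 P := by
  rw [h.eq_left]
  refine ⟨⟨h.le_isFG _ hP, fun C _ i hi _ => ?_⟩, hP⟩
  obtain ⟨i, rfl⟩ := Nat.exists_eq_add_of_le' hi
  exact Ext.subsingleton_of_projective P C i

theorem mem_of_injective (h : IsMaximalOrthogonal j 𝒞 𝒟) {J : ModuleCat.{u} A} [Injective J]
    (hJ : 𝒟 J) : 𝒞 J := by
  rw [h.eq_right]
  refine ⟨⟨h.le_isFG _ hJ, fun C _ i hi _ => ?_⟩, hJ⟩
  obtain ⟨i, rfl⟩ := Nat.exists_eq_add_of_le' hi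
  exact Ext.subsingleton_of_injective C J i

theorem subsingleton_ext (h : IsMaximalOrthogonal j 𝒞 𝒟) {X Y : ModuleCat.{u} A} (hX : 𝒞 X)
    (hY : 𝒞 Y) {i : ℕ} (hi : 1 ≤ i) (hij : i ≤ j) : Subsingleton (Ext.{u} X Y i) := by
  rw [h.eq_left] at hX
  exact hX.1.2 hY i hi hij

end IsMaximalOrthogonal

theorem IsMaximalOrthogonal.subsingleton_ext_regularDual (K : Type u) {A : Type u} [Field K]
    [Ring A] [Algebra K A] [FiniteDimensional K A] {j : ℕ} {𝒞 : ObjectProperty (ModuleCat.{u} A)}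
    (h : IsMaximalOrthogonal j 𝒞 (ModuleCat.isFG A)) {i : ℕ} (hi : 1 ≤ i) (hij : i ≤ j) :
    Subsingleton (Ext.{u} (ModuleCat.of A (RegularDual K A)) (ModuleCat.of A A) i) :=
  have : Projective (ModuleCat.of A A) := (IsProjective.iff_projective _).mp inferInstance
  h.subsingleton_ext (h.mem_of_injective (inferInstanceAs (Module.Finite A (RegularDual K A))))
    (h.mem_of_projective (inferInstanceAs (Module.Finite A A))) hi hij

end MaximalOrthogonal

theorem proposition5p1_general (K Λ Γ : Type u) [Field K]
    [Ring Λ] [Algebra K Λ] [FiniteDimensional K Λ]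
    [Ring Γ] [Algebra K Γ] [FiniteDimensional K Γ]
    (n : ℕ) (hΛ : injectiveDimension (ModuleCat.of Λ Λ) = (n : WithBot ℕ∞))
    (hExt : Subsingleton (Abelian.Ext.{u} (ModuleCat.of (Λ ⊗[K] Γ) (RegularDual K (Λ ⊗[K] Γ)))
      (ModuleCat.of (Λ ⊗[K] Γ) (Λ ⊗[K] Γ)) n)) :
    ∀ f : RegularDual K Γ →ₗ[Γ] Γ, f = 0 := by
  intro f
  by_contra hf
  have : HasInjectiveDimensionLT (ModuleCat.of Λ Λ) (n + 1) :=
    (injectiveDimension_le_iff _ _).mp hΛ.le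
  have : Subsingleton (Abelian.Ext.{u}
      ((coextendTensor K Λ Γ).obj (ModuleCat.of Λ (RegularDual K Λ)))
      (ModuleCat.of (Λ ⊗[K] Γ) (Λ ⊗[K] Γ)) n) :=
    subsingleton_ext_of_iso (X' := ModuleCat.of _ (RegularDual K (Λ ⊗[K] Γ)))
      regularDualTensorEquiv.symm.toModuleIso
  have := subsingleton_ext_of_coextendTensor hf (ModuleCat.of Λ (RegularDual K Λ)) n
  refine (injectiveDimension_ge_iff _ _).mp hΛ.ge ?_
  exact hasInjectiveDimensionLT_of_subsingleton_ext_regularDual K _ _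

theorem proposition5p1 (K Λ Γ : Type u) [Field K]
    [Ring Λ] [Algebra K Λ] [FiniteDimensional K Λ]
    [Ring Γ] [Algebra K Γ] [FiniteDimensional K Γ]
    (n : ℕ) (hn : 1 ≤ n)
    (hΛ : injectiveDimension (ModuleCat.of Λ Λ) = (n : WithBot ℕ∞))
    (hC : ∃ j : ℕ, n ≤ j ∧ ∃ 𝒞 : ObjectProperty (ModuleCat.{u} (Λ ⊗[K] Γ)),
      IsMaximalOrthogonal j 𝒞 (ModuleCat.isFG (Λ ⊗[K] Γ))) :
    ∀ f : RegularDual K Γ →ₗ[Γ] Γ, f = 0 := by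
  obtain ⟨j, hj, 𝒞, h𝒞⟩ := hC
  exact proposition5p1_general K Λ Γ n hΛ (h𝒞.subsingleton_ext_regularDual K hn hj)
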